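/- Let $E$ be a complex Hilbert space of finite dimension $d\ge 2$ (for instance $\mathbb C^d$), and let $H(t)$, $t\in\mathbb R$, be a measurable time-dependent self-adjoint operator on $E$, which may also contain Dirac-delta pulses $\sum_s A_s\,\delta(t-s)$ with self-adjoint $A_s$ (so that discrete-time dynamics such as quantum circuits is included). Suppose that $H$ is periodic, $H(t+T)=H(t)$ for some $T>0$, with finite strength $$B=\int_0^T\|H(t)\|_\infty\,dt<\infty ,$$ where $\|\cdot\|_\infty$ is the operator norm and a pulse $A_s\,\delta(t-s)$ contributes $\|A_s\|_\infty$ (one period $(0,T]$ of pulses is counted). Let $U(t)=\mathcal T\exp\!\big(-i\int_0^t H(\tau)\,d\tau\big)$, $t\ge 0$, be the time-evolution operator, that is, the limit of the time-ordered products $\prod_j \exp\!\big(-i\int_{(t_{j-1},t_j]}H(\tau)\,d\tau\big)$ over partitions of $[0,t]$ as the mesh tends to $0$. Then: 1. $H$ does not exhibit complete Hilbert-space ergodicity (CHSE). Here CHSE means that for every initial pure state $\psi_0=|\psi\rangle\langle\psi|$, $\|\psi\|=1$, the states $U(t)\psi_0U(t)^\dagger$, $t\ge 0$, are equidistributed with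 respect to the unitarily invariant (Haar) probability measure on the set $\mathbb P(E)$ of pure states: for every continuous $f:\mathbb P(E)\to\mathbb R$, $$\lim_{\tau\to\infty}\frac1\tau\int_0^\tau f\big(U(t)\psi_0U(t)^\dagger\big)\,dt=\int_{\mathrm U(E)}f\big(V\psi_0V^\dagger\big)\,dV ,$$ with $dV$ the Haar probability measure on the unitary group $\mathrm U(E)$. 2. $H$ does not exhibit complete unitary ergodicity (CUE). Here CUE means that the unitary channels $\mathcal U(t):\rho\mapsto U(t)\rho U(t)^\dagger$, $t\ge 0$, are equidistributed with respect to the Haar measure on the projective unitary group $\mathrm{PU}(E)=\{\rho\mapsto V\rho V^\dagger : V\in\mathrm U(E)\}$: for every continuous $f:\mathrm{PU}(E)\to\mathbb R$, $\lim_{\tau\to\infty}\frac1\tau\int_0^\tau f(\mathcal U(t))\,dt$ exists and equals $\int_{\mathrm U(E)} f(\rho\mapsto V\rho V^\dagger)\,dV$. -/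

import Mathlib

open MeasureTheory Filter Topology Set
open scoped ENNReal

noncomputable section

namespace QuantumErgodicity

section Unitary

variable (E : Type*) [NormedAddCommGroup E] [InnerProductSpace ℂ E] [CompleteSpace E]

/-- Linear operators on the Hilbert space `E`; `‖·‖` is the operator norm and `star` is the
adjoint. -/
abbrev Op : Type _ := E →L[ℂ] E

/-- The unitary group of `E`. -/
abbrev UnitaryOp : Type _ := unitary (Op E)

variable [FiniteDimensional ℂ E]

instance instCompactSpaceUnitaryOp : CompactSpace (UnitaryOp E) := by
  have : ProperSpace (Op E) := FiniteDimensional.proper ℂ (Op E)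
  refine isCompact_iff_compactSpace.mp ?_
  refine Metric.isCompact_of_isClosed_isBounded isClosed_unitary ?_
  rw [Metric.isBounded_iff_subset_closedBall 0]
  refine ⟨1, fun u hu => ?_⟩
  rw [mem_closedBall_zero_iff]
  rcases subsingleton_or_nontrivial (Op E) with h | h
  · rw [Subsingleton.elim u 0, norm_zero]
    exact zero_le_one
  · exact (CStarRing.norm_of_mem_unitary hu).le

/-- The Haar probability measure on the unitary group of `E`. -/
def haarUnitary : Measure (UnitaryOp E) :=
  Measure.haarMeasure (⊤ : TopologicalSpace.PositiveCompacts (UnitaryOp E))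

end Unitary

/-- A time-dependent Hamiltonian on the Hilbert space `E`, possibly with Dirac-delta pulses:
formally `H(t) = regular t + ∑ s, pulse s • δ(t - s)`. A Hamiltonian that is an ordinary function
of time has `pulse = 0`; a quantum circuit (discrete-time dynamics) has `regular = 0`. -/
structure Hamiltonian (E : Type*) [NormedAddCommGroup E] [InnerProductSpace ℂ E]
    [CompleteSpace E] where
  /-- the part of `H` that is an ordinary function of time -/
  regular : ℝ → Op E
  /-- the weight of the delta pulse at each time (zero if there is no pulse) -/
  pulse : ℝ → Op E
  regular_measurable : AEStronglyMeasurable regular volume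
  regular_selfAdjoint : ∀ t, IsSelfAdjoint (regular t)
  pulse_selfAdjoint : ∀ t, IsSelfAdjoint (pulse t)

variable {E : Type*} [NormedAddCommGroup E] [InnerProductSpace ℂ E] [CompleteSpace E]

namespace Hamiltonian

/-- `H(t + T) = H(t)`. -/
def IsPeriodic (H : Hamiltonian E) (T : ℝ) : Prop :=
  Function.Periodic H.regular T ∧ Function.Periodic H.pulse T

/-- The strength `B = ∫_0^T ‖H(t)‖ dt ∈ [0, ∞]` over one period, where a pulse `A δ(t - s)`
contributes `‖A‖`. The pulses at the two ends of the period are translates of one pulse and are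
counted once. If `B` is finite, then only countably many pulses are nonzero. -/
def strength (H : Hamiltonian E) (T : ℝ) : ℝ≥0∞ :=
  (∫⁻ t in Ioc 0 T, ‖H.regular t‖ₑ) + ∑' s : Ioc (0 : ℝ) T, ‖H.pulse s‖ₑ

/-- The operator `∫_{(a, b]} H(t) dt`, pulses included. -/
def action (H : Hamiltonian E) (a b : ℝ) : Op E :=
  (∫ t in a..b, H.regular t) + ∑' s : Ioc a b, H.pulse s

/-- The time-ordered product
`exp(-i ∫_{(p (n-1), p n]} H) ⋯ exp(-i ∫_{(p 1, p 2]} H) exp(-i ∫_{(p 0, p 1]} H)`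
over the first `n` cells of the partition `p`, later times to the left. -/
def orderedProd (H : Hamiltonian E) (p : ℕ → ℝ) : ℕ → Op E
  | 0 => 1
  | n + 1 =>
      NormedSpace.exp ((-Complex.I) • H.action (p n) (p (n + 1))) * H.orderedProd p n

/-- `U(t)` is, for every `t ≥ 0`, the time-ordered exponential `𝒯 exp(-i ∫_0^t H(τ) dτ)`:
the limit of the time-ordered products over partitions `0 = p 0 ≤ p 1 ≤ ⋯ ≤ p n = t` as the
mesh of the partition tends to `0`. -/
def IsPropagator (H : Hamiltonian E) (U : ℝ → Op E) : Prop :=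
  ∀ t : ℝ, 0 ≤ t → ∀ ε : ℝ, 0 < ε → ∃ δ : ℝ, 0 < δ ∧
    ∀ (n : ℕ) (p : ℕ → ℝ), Monotone p → p 0 = 0 → p n = t →
      (∀ j < n, p (j + 1) - p j < δ) → ‖H.orderedProd p n - U t‖ < ε

end Hamiltonian

variable (E) in
/-- The projective Hilbert space, as the set of rank-one projections `|ψ⟩⟨ψ|`, `‖ψ‖ = 1`. -/
def pureStates : Set (Op E) :=
  {ρ | ∃ ψ : E, ‖ψ‖ = 1 ∧ ρ = InnerProductSpace.rankOne ℂ ψ ψ}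

/-- The quantum channel `ρ ↦ V ρ V†`, as a linear map on operators. -/
def channel (V : Op E) : Op E →L[ℂ] Op E :=
  ContinuousLinearMap.mulLeftRight ℂ (Op E) V (star V)

variable (E) in
/-- The projective unitary group, as the set of unitary channels `ρ ↦ V ρ V†`. -/
def projectiveUnitaries : Set (Op E →L[ℂ] Op E) :=
  {C | ∃ V : UnitaryOp E, C = channel (V : Op E)}

/-- The infinite-time average `lim_{τ → ∞} (1/τ) ∫_0^τ g(t) dt` exists and equals `c`. -/
def HasTimeAverage (g : ℝ → ℝ) (c : ℝ) : Prop :=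
  Tendsto (fun τ : ℝ => (1 / τ) * ∫ t in (0 : ℝ)..τ, g t) atTop (𝓝 c)

/-- The dynamics generated by `H` exhibits complete Hilbert-space ergodicity: for every initial
pure state `ψ₀`, the limiting distribution of `U(t) ψ₀ U(t)†` over `t ≥ 0` exists (as a weak
limit) and is the Haar distribution on pure states, that is, the law of `V φ₀ V†` with `V`
Haar distributed. This law does not depend on the reference state `φ₀`; we take `φ₀ = ψ₀`. -/
def ExhibitsCHSE [FiniteDimensional ℂ E] (H : Hamiltonian E) : Prop :=
  ∃ U : ℝ → Op E, H.IsPropagator U ∧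
    ∀ ψ₀ ∈ pureStates E, ∀ f : Op E → ℝ, ContinuousOn f (pureStates E) →
      HasTimeAverage (fun t => f (channel (U t) ψ₀))
        (∫ V : UnitaryOp E, f (channel (V : Op E) ψ₀) ∂(haarUnitary E))

/-- The dynamics generated by `H` exhibits complete unitary ergodicity: the limiting
distribution of the channels `ρ ↦ U(t) ρ U(t)†` over `t ≥ 0` exists (as a weak limit) and is the
Haar distribution on unitary channels. -/
def ExhibitsCUE [FiniteDimensional ℂ E] (H : Hamiltonian E) : Prop :=
  ∃ U : ℝ → Op E, H.IsPropagator U ∧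
    ∀ f : (Op E →L[ℂ] Op E) → ℝ, ContinuousOn f (projectiveUnitaries E) →
      HasTimeAverage (fun t => f (channel (U t)))
        (∫ V : UnitaryOp E, f (channel (V : Op E)) ∂(haarUnitary E))

end QuantumErgodicity

end

/-! Periodicity gives `U (t + T) = U t * U T`, and the unitary `U T` has an eigenvector `ψ`, so the
pure state of `ψ` returns to itself after each period and its whole orbit is traced within `[0, T]`.
There the orbit has variation bounded by the finite strength (`norm_sub_le`), so an off-diagonal
matrix element along it stays in a compact `K ⊆ ℂ` that is a Lipschitz image of an interval, of
dimension at most one. Over all pure states this entry fills the disc of radius 1/2, which has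
dimension two, so some state has its entry outside `K`. The distance from the entry to `K` is then a
continuous test function that vanishes along the orbit but has positive Haar average, which refutes
CHSE. CUE would imply CHSE by evaluating channels at a fixed state. -/

namespace QuantumErgodicity

/-! ### Unitary exponentials in a C*-algebra. -/

section

variable {A : Type*} [CStarAlgebra A]

theorem norm_le_one_of_mem_unitary {V : A} (hV : V ∈ unitary A) : ‖V‖ ≤ 1 := by
  rcases subsingleton_or_nontrivial A with h | h
  · rw [Subsingleton.elim V 0, norm_zero]
    exact zero_le_one
  · exact (CStarRing.norm_of_mem_unitary hV).le

theorem exp_neg_I_smul_mem_unitary {a : A} (ha : IsSelfAdjoint a) :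
    NormedSpace.exp ((-Complex.I) • a) ∈ unitary A := by
  have h := (selfAdjoint.expUnitary (⟨-a, ha.neg⟩ : selfAdjoint A)).2
  rw [selfAdjoint.expUnitary_coe] at h
  simpa using h

/-- Mean value inequality along `u ↦ exp (-iua)`, whose derivative is a unitary times `-ia`. A bound
linear in `‖a‖` is what lets the strengths of successive cells add up. -/
theorem norm_exp_neg_I_smul_sub_one_le {a : A} (ha : IsSelfAdjoint a) :
    ‖NormedSpace.exp ((-Complex.I) • a) - 1‖ ≤ ‖a‖ := by
  have hd : ∀ s ∈ Icc (0 : ℝ) 1,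
      HasDerivWithinAt (fun u : ℝ => NormedSpace.exp (u • ((-Complex.I) • a)))
        (NormedSpace.exp (s • ((-Complex.I) • a)) * ((-Complex.I) • a)) (Icc 0 1) s :=
    fun s _ => (hasDerivAt_exp_smul_const ((-Complex.I) • a) s).hasDerivWithinAt
  have h := norm_image_sub_le_of_norm_deriv_le_segment_01' (C := ‖a‖) hd fun s _ => by
    have hu : NormedSpace.exp (s • ((-Complex.I) • a)) ∈ unitary A := by
      rw [smul_comm]
      exact exp_neg_I_smul_mem_unitary ((IsSelfAdjoint.all s).smul ha)
    calc _ ≤ ‖NormedSpace.exp (s • ((-Complex.I) • a))‖ * ‖(-Complex.I) • a‖ := norm_mul_le _ _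
      _ ≤ 1 * ‖a‖ := by
        gcongr
        · exact norm_le_one_of_mem_unitary hu
        · simp [norm_smul]
      _ = ‖a‖ := one_mul _
  simpa using h

/-- `star` is a real-linear homeomorphism, so it commutes with the Bochner integral even when `f` is
not integrable. -/
theorem isSelfAdjoint_integral {X : Type*} [MeasurableSpace X] {μ : Measure X} {f : X → A}
    (hf : ∀ x, IsSelfAdjoint (f x)) : IsSelfAdjoint (∫ x, f x ∂μ) := by
  have h := (starL' ℝ : A ≃L[ℝ] A).integral_comp_comm (μ := μ) f
  have h2 : ∀ t, (starL' ℝ : A ≃L[ℝ] A) (f t) = f t := fun t => hf t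
  simp only [h2] at h
  exact h.symm

end

/-! ### Time-ordered products and the propagator. -/

section

variable {E : Type*} [NormedAddCommGroup E] [InnerProductSpace ℂ E] [CompleteSpace E]

namespace Hamiltonian

variable (H : Hamiltonian E)

theorem action_selfAdjoint (a b : ℝ) : IsSelfAdjoint (H.action a b) := by
  refine IsSelfAdjoint.add ?_ ?_
  · exact (isSelfAdjoint_integral H.regular_selfAdjoint).sub
      (isSelfAdjoint_integral H.regular_selfAdjoint)
  · rw [IsSelfAdjoint, tsum_star]
    exact tsum_congr fun s => H.pulse_selfAdjoint s

theorem action_add_period {T : ℝ} (hper : H.IsPeriodic T) (a b : ℝ) :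
    H.action (a + T) (b + T) = H.action a b := by
  unfold action
  congr 1
  · rw [← intervalIntegral.integral_comp_add_right]
    simp only [hper.1 _]
  · let e : Ioc a b ≃ Ioc (a + T) (b + T) :=
      { toFun := fun s => ⟨s + T, by
          have := s.2; constructor <;> [linarith [this.1]; linarith [this.2]]⟩
        invFun := fun s => ⟨s - T, by
          have := s.2; constructor <;> [linarith [this.1]; linarith [this.2]]⟩
        left_inv := fun s => by simp
        right_inv := fun s => by simp }
    rw [← e.tsum_eq]
    exact tsum_congr fun s => hper.2 s

/-- The strength of `H` on the interval `(a, b]`, pulses included. -/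
noncomputable def strengthOn (a b : ℝ) : ℝ≥0∞ :=
  (∫⁻ t in Ioc a b, ‖H.regular t‖ₑ) + ∑' s : Ioc a b, ‖H.pulse s‖ₑ

theorem enorm_action_le {a b : ℝ} (hab : a ≤ b) : ‖H.action a b‖ₑ ≤ H.strengthOn a b := by
  refine (enorm_add_le _ _).trans (add_le_add ?_ enorm_tsum_le_tsum_enorm)
  rw [intervalIntegral.integral_of_le hab]
  exact enorm_integral_le_lintegral_enorm _

theorem strengthOn_add {a b c : ℝ} (hab : a ≤ b) (hbc : b ≤ c) :
    H.strengthOn a b + H.strengthOn b c = H.strengthOn a c := by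
  have hd : Disjoint (Ioc a b) (Ioc b c) := Ioc_disjoint_Ioc_of_le le_rfl
  unfold strengthOn
  rw [← Ioc_union_Ioc_eq_Ioc hab hbc, lintegral_union measurableSet_Ioc hd,
    ENNReal.summable.tsum_union_disjoint (f := fun s => ‖H.pulse s‖ₑ) hd ENNReal.summable]
  ring

@[simp]
theorem strengthOn_self (a : ℝ) : H.strengthOn a a = 0 := by
  simp [strengthOn]

theorem orderedProd_mem_unitary (p : ℕ → ℝ) (n : ℕ) : H.orderedProd p n ∈ unitary (Op E) := by
  induction n with
  | zero => exact one_mem _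
  | succ n ih => exact mul_mem (exp_neg_I_smul_mem_unitary (H.action_selfAdjoint _ _)) ih

/-- Telescoping: each new factor `X` adds `(X - 1)` times a unitary, which costs at most the
strength of its cell. -/
theorem enorm_orderedProd_sub_one_le {p : ℕ → ℝ} (hp : Monotone p) (n : ℕ) :
    ‖H.orderedProd p n - 1‖ₑ ≤ H.strengthOn (p 0) (p n) := by
  induction n with
  | zero => simp [orderedProd]
  | succ n ih =>
    have hA := H.action_selfAdjoint (p n) (p (n + 1))
    set X := NormedSpace.exp ((-Complex.I) • H.action (p n) (p (n + 1))) with hX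
    have hle : p n ≤ p (n + 1) := hp n.le_succ
    have hXe : ‖X - 1‖ₑ ≤ H.strengthOn (p n) (p (n + 1)) :=
      (enorm_le_iff_norm_le.2 (norm_exp_neg_I_smul_sub_one_le hA)).trans (H.enorm_action_le hle)
    have hu : ‖H.orderedProd p n‖ₑ ≤ 1 := by
      rw [← ofReal_norm, ← ENNReal.ofReal_one]
      exact ENNReal.ofReal_le_ofReal (norm_le_one_of_mem_unitary (H.orderedProd_mem_unitary p n))
    have he : H.orderedProd p (n + 1) - 1
        = (H.orderedProd p n - 1) + (X - 1) * H.orderedProd p n := by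
      rw [orderedProd, ← hX, sub_mul, one_mul]; abel
    rw [he, ← H.strengthOn_add (hp n.zero_le) hle]
    refine (enorm_add_le _ _).trans (add_le_add ih ?_)
    calc _ ≤ ‖X - 1‖ₑ * ‖H.orderedProd p n‖ₑ := by
          simp only [← ofReal_norm]
          rw [← ENNReal.ofReal_mul (norm_nonneg _)]
          exact ENNReal.ofReal_le_ofReal (norm_mul_le _ _)
      _ ≤ H.strengthOn (p n) (p (n + 1)) * 1 := by gcongr
      _ = _ := mul_one _

theorem orderedProd_add (p : ℕ → ℝ) (n m : ℕ) :
    H.orderedProd p (n + m) = H.orderedProd (fun j => p (n + j)) m * H.orderedProd p n := by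
  induction m with
  | zero => simp [orderedProd]
  | succ m ih => rw [← add_assoc, orderedProd, ih, orderedProd, mul_assoc]; rfl

theorem orderedProd_add_period {T : ℝ} (hper : H.IsPeriodic T) (p : ℕ → ℝ) (n : ℕ) :
    H.orderedProd (fun j => p j + T) n = H.orderedProd p n := by
  induction n with
  | zero => rfl
  | succ n ih => rw [orderedProd, orderedProd, ih, H.action_add_period hper]

/-- Fine partitions of `[0, t]` through a given intermediate point `s`. -/
theorem exists_partition {s t : ℝ} (hs : 0 ≤ s) (hst : s ≤ t) {δ : ℝ} (hδ : 0 < δ) :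
    ∃ (n : ℕ) (p : ℕ → ℝ), Monotone p ∧ p 0 = 0 ∧ p n = s ∧ p (n + n) = t ∧
      ∀ j, p (j + 1) - p j < δ := by
  obtain ⟨n, hn⟩ := exists_nat_gt (t / δ)
  have hn0 : (0 : ℝ) < n := (div_nonneg (hs.trans hst) hδ.le).trans_lt hn
  have hts : 0 ≤ t - s := sub_nonneg.2 hst
  have hmin (j : ℕ) : ((min (j + 1) n : ℕ) : ℝ) ≤ (min j n : ℕ) + 1 := by
    exact_mod_cast (by omega : min (j + 1) n ≤ min j n + 1)
  have hsub (j : ℕ) : ((j + 1 - n : ℕ) : ℝ) ≤ (j - n : ℕ) + 1 := by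
    exact_mod_cast (by omega : j + 1 - n ≤ j - n + 1)
  -- `n` equal steps from `0` to `s`, then `n` equal steps from `s` to `t`; the truncated `j - n`
  -- vanishes during the first half. Every increment is at most `s / n + (t - s) / n = t / n < δ`.
  refine ⟨n, fun j => s / n * (min j n : ℕ) + (t - s) / n * (j - n : ℕ), ?_, ?_, ?_, ?_, ?_⟩
  · intro i j hij
    have h1 : ((min i n : ℕ) : ℝ) ≤ (min j n : ℕ) := by
      exact_mod_cast (by omega : min i n ≤ min j n)
    have h2 : ((i - n : ℕ) : ℝ) ≤ (j - n : ℕ) := by exact_mod_cast (by omega : i - n ≤ j - n)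
    dsimp only
    gcongr
  · simp
  · simp [hn0.ne']
  · simp [hn0.ne']
  · intro j
    have h1 := mul_le_mul_of_nonneg_left (hmin j) (div_nonneg hs hn0.le)
    have h2 := mul_le_mul_of_nonneg_left (hsub j) (div_nonneg hts hn0.le)
    have h3 : s / n + (t - s) / n = t / n := by ring
    have h4 : t / n < δ := by
      rw [div_lt_iff₀ hδ] at hn
      rw [div_lt_iff₀ hn0]; linarith
    dsimp only
    linarith

variable {H} {U : ℝ → Op E}

/-- Along suitable partitions, the time-ordered products converge to `U s` and to `U t`
simultaneously. -/
theorem IsPropagator.exists_approx (hU : H.IsPropagator U) {s t : ℝ} (hs : 0 ≤ s) (hst : s ≤ t)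
    {ε δ : ℝ} (hε : 0 < ε) (hδ : 0 < δ) :
    ∃ (n : ℕ) (p : ℕ → ℝ), Monotone p ∧ p 0 = 0 ∧ p n = s ∧ p (n + n) = t ∧
      (∀ j, p (j + 1) - p j < δ) ∧ ‖H.orderedProd p n - U s‖ < ε ∧
      ‖H.orderedProd p (n + n) - U t‖ < ε := by
  obtain ⟨δ₁, h₁, H₁⟩ := hU s hs ε hε
  obtain ⟨δ₂, h₂, H₂⟩ := hU t (hs.trans hst) ε hε
  obtain ⟨n, p, hp, hp0, hpn, hpm, hmesh⟩ := exists_partition hs hst (lt_min hδ (lt_min h₁ h₂))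
  refine ⟨n, p, hp, hp0, hpn, hpm, fun j => (hmesh j).trans_le (min_le_left _ _),
    H₁ n p hp hp0 hpn fun j _ => ?_, H₂ _ p hp hp0 hpm fun j _ => ?_⟩
  · exact (hmesh j).trans_le ((min_le_right _ _).trans (min_le_left _ _))
  · exact (hmesh j).trans_le ((min_le_right _ _).trans (min_le_right _ _))

theorem IsPropagator.mem_unitary (hU : H.IsPropagator U) {t : ℝ} (ht : 0 ≤ t) :
    U t ∈ unitary (Op E) := by
  refine isClosed_unitary.closure_subset_iff.2 subset_rfl (Metric.mem_closure_iff.2 fun ε hε => ?_)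
  obtain ⟨n, p, -, -, -, -, -, h, -⟩ := hU.exists_approx ht le_rfl hε one_pos
  exact ⟨_, H.orderedProd_mem_unitary p n, by rwa [dist_comm, dist_eq_norm]⟩

theorem IsPropagator.norm_sub_le (hU : H.IsPropagator U) {s t : ℝ} (hs : 0 ≤ s) (hst : s ≤ t)
    (hfin : H.strengthOn s t ≠ ⊤) : ‖U t - U s‖ ≤ (H.strengthOn s t).toReal := by
  refine le_of_forall_pos_le_add fun ε hε => ?_
  obtain ⟨n, p, hp, hp0, hpn, hpm, -, h₁, h₂⟩ := hU.exists_approx hs hst (half_pos hε) one_pos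
  have hR := H.enorm_orderedProd_sub_one_le (p := fun j => p (n + j))
    (fun i j hij => hp (by omega)) n
  simp only [add_zero, hpn, hpm] at hR
  have hR' : ‖H.orderedProd (fun j => p (n + j)) n - 1‖ ≤ (H.strengthOn s t).toReal := by
    rw [← toReal_enorm]
    exact ENNReal.toReal_mono hfin hR
  have hprod : ‖H.orderedProd p (n + n) - H.orderedProd p n‖ ≤ (H.strengthOn s t).toReal := by
    have he : H.orderedProd p (n + n) - H.orderedProd p n
        = (H.orderedProd (fun j => p (n + j)) n - 1) * H.orderedProd p n := by
      rw [orderedProd_add, sub_mul, one_mul]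
    rw [he]
    calc _ ≤ _ * _ := norm_mul_le _ _
      _ ≤ (H.strengthOn s t).toReal * 1 := by
        gcongr
        exact norm_le_one_of_mem_unitary (H.orderedProd_mem_unitary p n)
      _ = _ := mul_one _
  have he : U t - U s = (H.orderedProd p (n + n) - H.orderedProd p n)
      - (H.orderedProd p (n + n) - U t) + (H.orderedProd p n - U s) := by abel
  rw [he]
  have h3 := norm_add_le ((H.orderedProd p (n + n) - H.orderedProd p n)
      - (H.orderedProd p (n + n) - U t)) (H.orderedProd p n - U s)
  have h4 := _root_.norm_sub_le (H.orderedProd p (n + n) - H.orderedProd p n)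
      (H.orderedProd p (n + n) - U t)
  linarith

/-- A fine partition of `[0, t + T]` through `T` splits the ordered product in two; its second half,
shifted back by `T`, is a fine partition of `[0, t]` with the same product. -/
theorem IsPropagator.add_period (hU : H.IsPropagator U) {T : ℝ} (hT : 0 ≤ T)
    (hper : H.IsPeriodic T) {t : ℝ} (ht : 0 ≤ t) : U (t + T) = U t * U T := by
  rw [← sub_eq_zero, ← norm_le_zero_iff]
  refine le_of_forall_pos_le_add fun ε hε => ?_
  have hε3 : 0 < ε / 3 := by positivity
  obtain ⟨δ, hδ, hconv⟩ := hU t ht (ε / 3) hε3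
  obtain ⟨n, p, hp, hp0, hpn, hpm, hmesh, h₁, h₂⟩ :=
    hU.exists_approx hT (le_add_of_nonneg_left ht) hε3 hδ
  have h₃ := hconv n (fun j => p (n + j) - T) (fun i j hij => by
      have := hp (by omega : n + i ≤ n + j)
      dsimp only; linarith) (by simp [hpn]) (by simp [hpm]) fun j _ => by
    have := hmesh (n + j)
    rw [← add_assoc]; linarith
  rw [← H.orderedProd_add_period hper] at h₃
  simp only [sub_add_cancel] at h₃
  rw [orderedProd_add] at h₂
  set R := H.orderedProd (fun j => p (n + j)) n with hR
  set P := H.orderedProd p n with hP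
  have he : U (t + T) - U t * U T = -(R * P - U (t + T)) + (R - U t) * P + U t * (P - U T) := by
    noncomm_ring
  have hPn : ‖P‖ ≤ 1 := norm_le_one_of_mem_unitary (H.orderedProd_mem_unitary _ _)
  have hUn : ‖U t‖ ≤ 1 := norm_le_one_of_mem_unitary (hU.mem_unitary ht)
  rw [he]
  have h5 : ‖(R - U t) * P‖ ≤ ε / 3 := (norm_mul_le _ _).trans (by
    nlinarith [norm_nonneg P, norm_nonneg (R - U t)])
  have h6 : ‖U t * (P - U T)‖ ≤ ε / 3 := (norm_mul_le _ _).trans (by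
    nlinarith [norm_nonneg (U t), norm_nonneg (P - U T)])
  have h7 := norm_add₃_le (a := -(R * P - U (t + T))) (b := (R - U t) * P) (c := U t * (P - U T))
  rw [norm_neg] at h7
  linarith

theorem IsPropagator.add_nat_mul_period (hU : H.IsPropagator U) {T : ℝ} (hT : 0 ≤ T)
    (hper : H.IsPeriodic T) {t : ℝ} (ht : 0 ≤ t) (n : ℕ) : U (t + n * T) = U t * U T ^ n := by
  induction n with
  | zero => simp
  | succ n ih =>
    rw [Nat.cast_succ, add_mul, one_mul, ← add_assoc, hU.add_period hT hper (by positivity), ih,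
      pow_succ, mul_assoc]

end Hamiltonian

end

/-! ### Curves of dimension at most one, and the disc of off-diagonal entries. -/

section

/-- A curve in `ℂ` of bounded variation, controlled by a function `g : ℝ → [0, B]`, lies in a
compact set of Hausdorff dimension at most one. -/
theorem exists_isCompact_dimH_le_one {γ : ℝ → ℂ} {g : ℝ → ℝ} {S : Set ℝ} {B : ℝ}
    (hB : ∀ t ∈ S, g t ∈ Icc 0 B) {C : NNReal}
    (hγ : ∀ s ∈ S, ∀ t ∈ S, dist (γ s) (γ t) ≤ C * dist (g s) (g t)) :
    ∃ K : Set ℂ, IsCompact K ∧ dimH K ≤ 1 ∧ ∀ t ∈ S, γ t ∈ K := by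
  have hinv (t) (ht : t ∈ S) := Function.invFunOn_pos (f := g) (s := S) ⟨t, ht, rfl⟩
  -- By `hγ`, `γ t` depends only on `g t`, so `γ` factors through `g` by a Lipschitz map on `g ''
  -- S`.
  have hL : LipschitzOnWith C (fun x => γ (Function.invFunOn g S x)) (g '' S) := by
    refine LipschitzOnWith.of_dist_le_mul ?_
    rintro _ ⟨s, hs, rfl⟩ _ ⟨t, ht, rfl⟩
    obtain ⟨hs1, hs2⟩ := hinv s hs
    obtain ⟨ht1, ht2⟩ := hinv t ht
    simpa only [hs2, ht2] using hγ _ hs1 _ ht1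
  -- `g '' S` may have gaps; extending to all of `ℝ` makes the image of `Icc 0 B` compact.
  obtain ⟨h, hLip, heq⟩ := hL.extend_finite_dimension
  refine ⟨h '' Icc 0 B, isCompact_Icc.image hLip.continuous, ?_, fun t ht => ⟨g t, hB t ht, ?_⟩⟩
  · calc dimH (h '' Icc 0 B) ≤ dimH (Icc 0 B) := hLip.dimH_image_le _
      _ ≤ dimH (univ : Set ℝ) := dimH_mono (subset_univ _)
      _ = 1 := Real.dimH_univ
  · rw [← heq ⟨t, ht, rfl⟩]
    obtain ⟨ht1, ht2⟩ := hinv t ht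
    have := hγ _ ht1 _ ht
    rw [ht2, dist_self, mul_zero] at this
    exact dist_le_zero.1 this

theorem exists_mem_ball_notMem {K : Set ℂ} (hK : dimH K ≤ 1) {r : ℝ} (hr : 0 < r) :
    ∃ z ∈ Metric.ball (0 : ℂ) r, z ∉ K := by
  by_contra! h
  have h2 := Real.dimH_of_mem_nhds (Metric.ball_mem_nhds (0 : ℂ) hr)
  rw [Complex.finrank_real_complex] at h2
  have h3 := (dimH_mono (h : Metric.ball (0 : ℂ) r ⊆ K)).trans hK
  rw [h2] at h3
  norm_num at h3

theorem exists_mul_eq_of_norm_lt_half {z : ℂ} (hz : ‖z‖ < 1 / 2) :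
    ∃ (a : ℝ) (b : ℂ), a ^ 2 + ‖b‖ ^ 2 = 1 ∧ a * b = z := by
  have h0 : 0 ≤ 1 - 4 * ‖z‖ ^ 2 := by nlinarith [norm_nonneg z]
  set r := √(1 - 4 * ‖z‖ ^ 2) with hr
  have hr2 : r ^ 2 = 1 - 4 * ‖z‖ ^ 2 := Real.sq_sqrt h0
  have hr0 : 0 ≤ r := Real.sqrt_nonneg _
  have hx : 0 < (1 + r) / 2 := by positivity
  have hx2 : √((1 + r) / 2) ^ 2 = (1 + r) / 2 := Real.sq_sqrt hx.le
  have hx0 : (√((1 + r) / 2) : ℂ) ≠ 0 := by exact_mod_cast (Real.sqrt_pos.2 hx).ne'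
  -- `a ^ 2` must solve `x + ‖z‖ ^ 2 / x = 1`; the larger root is nonzero even for `z = 0`.
  refine ⟨√((1 + r) / 2), z / √((1 + r) / 2), ?_, mul_div_cancel₀ _ hx0⟩
  rw [norm_div, div_pow, Complex.norm_real, Real.norm_eq_abs, sq_abs, hx2]
  field_simp
  nlinarith

end

/-! ### Pure states, channels and Haar averages. -/

section

variable {E : Type*} [NormedAddCommGroup E] [InnerProductSpace ℂ E]

/-- Every complex number of modulus less than `1 / 2` is an off-diagonal entry of some pure
state. -/
theorem exists_norm_eq_one_inner_mul_inner {e₀ e₁ : E} (h₀ : ‖e₀‖ = 1) (h₁ : ‖e₁‖ = 1)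
    (h : inner ℂ e₀ e₁ = 0) {z : ℂ} (hz : ‖z‖ < 1 / 2) :
    ∃ ψ : E, ‖ψ‖ = 1 ∧ inner ℂ ψ e₀ * inner ℂ e₁ ψ = z := by
  obtain ⟨a, b, hab, hz⟩ := exists_mul_eq_of_norm_lt_half hz
  have h' : inner ℂ e₁ e₀ = 0 := inner_eq_zero_symm.1 h
  refine ⟨(a : ℂ) • e₀ + b • e₁, ?_, ?_⟩
  · have := norm_add_sq_eq_norm_sq_add_norm_sq_of_inner_eq_zero (𝕜 := ℂ)
      ((a : ℂ) • e₀) (b • e₁) (by rw [inner_smul_left, inner_smul_right, h]; simp)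
    rw [norm_smul, norm_smul, h₀, h₁, mul_one, mul_one, Complex.norm_real, Real.norm_eq_abs,
      ← sq, ← sq, ← sq, sq_abs, hab] at this
    exact (pow_eq_one_iff_of_nonneg (norm_nonneg _) two_ne_zero).1 this
  · simp [h', h₀, h₁, hz]

/-- Global phases drop out, so an eigenvector of `U T` gives a fixed point of its channel. -/
theorem rankOne_smul_self {c : ℂ} (hc : ‖c‖ = 1) (ψ : E) :
    InnerProductSpace.rankOne ℂ (c • ψ) (c • ψ) = InnerProductSpace.rankOne ℂ ψ ψ := by
  ext x
  have h : c * inner ℂ ψ x * (starRingEnd ℂ) c = inner ℂ ψ x := by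
    rw [mul_right_comm, Complex.mul_conj', hc]
    simp
  simp [smul_smul, mul_right_comm, h]

variable [CompleteSpace E]

theorem channel_rankOne (V : Op E) (ψ : E) :
    channel V (InnerProductSpace.rankOne ℂ ψ ψ) = InnerProductSpace.rankOne ℂ (V ψ) (V ψ) := by
  ext x
  simp [channel, ContinuousLinearMap.star_eq_adjoint, ContinuousLinearMap.adjoint_inner_right]

theorem channel_mul (V W : Op E) : channel (V * W) = (channel V).comp (channel W) := by
  ext ρ x
  simp [channel, mul_assoc]

theorem norm_apply_of_mem_unitary {V : Op E} (hV : V ∈ unitary (Op E)) (x : E) :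
    ‖V x‖ = ‖x‖ :=
  (Unitary.linearIsometryEquiv ⟨V, hV⟩).norm_map x

theorem continuous_channel : Continuous (channel : Op E → Op E →L[ℂ] Op E) := by
  unfold channel
  exact ((ContinuousLinearMap.mulLeftRight ℂ (Op E)).continuous).clm_apply continuous_star

theorem channel_mem_pureStates {V : Op E} (hV : V ∈ unitary (Op E)) {ρ : Op E}
    (hρ : ρ ∈ pureStates E) : channel V ρ ∈ pureStates E := by
  obtain ⟨ψ, hψ, rfl⟩ := hρ
  exact ⟨V ψ, by rw [norm_apply_of_mem_unitary hV, hψ], channel_rankOne V ψ⟩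

variable [FiniteDimensional ℂ E]

/-- The unitary group acts transitively on unit vectors. -/
theorem exists_unitary_apply_eq {ψ φ : E} (hψ : ‖ψ‖ = 1) (hφ : ‖φ‖ = 1) :
    ∃ V : UnitaryOp E, (V : Op E) ψ = φ := by
  -- Both vectors are placed at index `0` of an orthonormal basis; the unitary carries one basis to
  -- the other.
  have key (χ : E) (hχ : ‖χ‖ = 1) : ∃ (b : OrthonormalBasis (Fin (Module.finrank ℂ E)) ℂ E)
      (i : Fin (Module.finrank ℂ E)), i.1 = 0 ∧ b i = χ := by
    have : Nontrivial E := ⟨χ, 0, by rintro rfl; simp at hχ⟩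
    let i : Fin (Module.finrank ℂ E) := ⟨0, Module.finrank_pos⟩
    have ho : Orthonormal ℂ (({i} : Set (Fin (Module.finrank ℂ E))).domRestrict fun _ => χ) :=
      ⟨fun _ => hχ, fun a b hab => (hab (Subsingleton.elim a b)).elim⟩
    obtain ⟨b, hb⟩ := ho.exists_orthonormalBasis_extension_of_card_eq (by simp)
    exact ⟨b, i, rfl, hb i rfl⟩
  obtain ⟨b, i, hi, rfl⟩ := key ψ hψ
  obtain ⟨c, j, hj, rfl⟩ := key φ hφ
  obtain rfl : i = j := Fin.ext (hi.trans hj.symm)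
  refine ⟨Unitary.linearIsometryEquiv.symm (b.equiv c (Equiv.refl _)), ?_⟩
  simp

theorem ExhibitsCUE.exhibitsCHSE {H : Hamiltonian E} (h : ExhibitsCUE H) : ExhibitsCHSE H := by
  obtain ⟨U, hU, hlim⟩ := h
  refine ⟨U, hU, fun ψ₀ hψ₀ f hf => hlim (fun C => f (C ψ₀)) ?_⟩
  refine hf.comp (by fun_prop) ?_
  rintro _ ⟨V, rfl⟩
  exact channel_mem_pureStates V.2 hψ₀

theorem exists_unit_eigenvector [Nontrivial E] {V : Op E} (hV : V ∈ unitary (Op E)) :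
    ∃ (ψ : E) (c : ℂ), ‖ψ‖ = 1 ∧ ‖c‖ = 1 ∧ V ψ = c • ψ := by
  obtain ⟨c, hc⟩ := Module.End.exists_eigenvalue (V : E →ₗ[ℂ] E)
  obtain ⟨v, hv⟩ := hc.exists_hasEigenvector
  have hv0 : ‖v‖ ≠ 0 := norm_ne_zero_iff.2 hv.2
  have hVv : V v = c • v := hv.apply_eq_smul
  refine ⟨((‖v‖⁻¹ : ℝ) : ℂ) • v, c, ?_, ?_, ?_⟩
  · rw [norm_smul, Complex.norm_real, norm_inv, norm_norm, inv_mul_cancel₀ hv0]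
  · have := norm_apply_of_mem_unitary hV v
    rw [hVv, norm_smul] at this
    exact mul_right_cancel₀ hv0 (this.trans (one_mul _).symm)
  · rw [map_smul, hVv, smul_comm]

theorem integral_haarUnitary_pos {f : UnitaryOp E → ℝ} (hf : Continuous f) (h0 : ∀ V, 0 ≤ f V)
    {V : UnitaryOp E} (hV : f V ≠ 0) : 0 < ∫ V, f V ∂(haarUnitary E) := by
  have h1 : (haarUnitary E).IsOpenPosMeasure := by unfold haarUnitary; infer_instance
  have h2 : IsFiniteMeasureOnCompacts (haarUnitary E) := by unfold haarUnitary; infer_instance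
  exact hf.integral_pos_of_hasCompactSupport_nonneg_nonzero (HasCompactSupport.of_compactSpace f)
    h0 hV

theorem HasTimeAverage.eq_zero {g : ℝ → ℝ} {c : ℝ} (h : HasTimeAverage g c)
    (hg : ∀ t, 0 ≤ t → g t = 0) : c = 0 := by
  refine tendsto_nhds_unique h (tendsto_const_nhds.congr' ?_)
  filter_upwards [eventually_ge_atTop 0] with τ hτ
  rw [intervalIntegral.integral_congr (g := fun _ => 0) fun t ht => hg t (by
    rw [uIcc_of_le hτ] at ht; exact ht.1)]
  simp

end

/-! ### The periodic orbit and the contradiction. -/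

section

variable {E : Type*} [NormedAddCommGroup E] [InnerProductSpace ℂ E] [CompleteSpace E]
  {H : Hamiltonian E} {U : ℝ → Op E}

/-- Over one period, a matrix element of the evolution of a pure state stays in a compact set of
Hausdorff dimension at most one. -/
theorem Hamiltonian.IsPropagator.exists_isCompact_dimH_le_one (hU : H.IsPropagator U) {T : ℝ}
    (hB : H.strength T < ⊤) (ψ e₀ e₁ : E) (hψ : ‖ψ‖ = 1) (h₀ : ‖e₀‖ = 1) (h₁ : ‖e₁‖ = 1) :
    ∃ K : Set ℂ, IsCompact K ∧ dimH K ≤ 1 ∧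
      ∀ t ∈ Icc 0 T, inner ℂ (U t ψ) e₀ * inner ℂ e₁ (U t ψ) ∈ K := by
  have hfin (s t) (hs : 0 ≤ s) (hst : s ≤ t) (ht : t ≤ T) : H.strengthOn s t ≠ ⊤ := by
    refine ne_top_of_le_ne_top hB.ne ?_
    change _ ≤ H.strengthOn 0 T
    rw [← H.strengthOn_add hs (hst.trans ht), ← H.strengthOn_add hst ht]
    exact le_add_self.trans' le_self_add
  have hsub (s t) (hs : 0 ≤ s) (hst : s ≤ t) (ht : t ≤ T) : (H.strengthOn 0 s).toReal
      + (H.strengthOn s t).toReal = (H.strengthOn 0 t).toReal := by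
    rw [← H.strengthOn_add hs hst, ENNReal.toReal_add (hfin 0 s le_rfl hs (hst.trans ht))
      (hfin s t hs hst ht)]
  -- Time is reparametrized by accumulated strength. The constant 2 comes from the product rule for
  -- two factors of modulus at most one.
  refine QuantumErgodicity.exists_isCompact_dimH_le_one
    (g := fun t => (H.strengthOn 0 t).toReal) (B := (H.strengthOn 0 T).toReal) (C := 2)
    (fun t ht => ⟨ENNReal.toReal_nonneg, ?_⟩) ?_
  · have := hsub t T ht.1 ht.2 le_rfl
    linarith [ENNReal.toReal_nonneg (a := H.strengthOn t T)]
  intro s hs t ht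
  wlog hst : s ≤ t generalizing s t
  · rw [dist_comm, dist_comm (H.strengthOn 0 s).toReal]
    exact this t ht s hs (le_of_not_ge hst)
  have hg : dist (H.strengthOn 0 s).toReal (H.strengthOn 0 t).toReal
      = (H.strengthOn s t).toReal := by
    rw [← hsub s t hs.1 hst ht.2, Real.dist_eq, sub_add_cancel_left, abs_neg,
      abs_of_nonneg ENNReal.toReal_nonneg]
  rw [hg]
  have hn : ‖U t ψ - U s ψ‖ ≤ (H.strengthOn s t).toReal := by
    have h := ((U t - U s).le_opNorm ψ).trans_eq (by rw [hψ, mul_one])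
    exact h.trans (hU.norm_sub_le hs.1 hst (hfin s t hs.1 hst ht.2))
  have hs1 : ‖U s ψ‖ = 1 := by rw [norm_apply_of_mem_unitary (hU.mem_unitary hs.1), hψ]
  have ht1 : ‖U t ψ‖ = 1 := by rw [norm_apply_of_mem_unitary (hU.mem_unitary ht.1), hψ]
  have he : inner ℂ (U t ψ) e₀ * inner ℂ e₁ (U t ψ) - inner ℂ (U s ψ) e₀ * inner ℂ e₁ (U s ψ)
      = inner ℂ (U t ψ - U s ψ) e₀ * inner ℂ e₁ (U t ψ)
        + inner ℂ (U s ψ) e₀ * inner ℂ e₁ (U t ψ - U s ψ) := by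
    rw [inner_sub_left, inner_sub_right]; ring
  rw [dist_comm, dist_eq_norm, he]
  calc _ ≤ _ := norm_add_le _ _
    _ ≤ ‖U t ψ - U s ψ‖ * ‖e₀‖ * (‖e₁‖ * ‖U t ψ‖)
        + ‖U s ψ‖ * ‖e₀‖ * (‖e₁‖ * ‖U t ψ - U s ψ‖) := by
      rw [norm_mul, norm_mul]
      gcongr <;> exact norm_inner_le_norm _ _
    _ = 2 * ‖U t ψ - U s ψ‖ := by rw [hs1, ht1, h₀, h₁]; ring
    _ ≤ _ := by push_cast; gcongr

/-- A periodic Hamiltonian evolves an eigenstate of `U T` periodically. -/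
theorem Hamiltonian.IsPropagator.exists_mem_Icc_channel_eq (hU : H.IsPropagator U) {T : ℝ}
    (hT : 0 < T) (hper : H.IsPeriodic T) {ρ : Op E} (hρ : channel (U T) ρ = ρ) {t : ℝ}
    (ht : 0 ≤ t) : ∃ s ∈ Icc 0 T, channel (U t) ρ = channel (U s) ρ := by
  have hpow (n : ℕ) : channel (U T ^ n) ρ = ρ := by
    induction n with
    | zero => ext; simp [channel]
    | succ n ih => rw [pow_succ, channel_mul, ContinuousLinearMap.comp_apply, hρ, ih]
  have hn : (⌊t / T⌋₊ : ℝ) * T ≤ t := (le_div_iff₀ hT).1 (Nat.floor_le (by positivity))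
  have hn' : t < (⌊t / T⌋₊ + 1) * T := (div_lt_iff₀ hT).1 (Nat.lt_floor_add_one _)
  refine ⟨t - ⌊t / T⌋₊ * T, ⟨sub_nonneg.2 hn, by linarith⟩, ?_⟩
  conv_lhs => rw [← sub_add_cancel t (⌊t / T⌋₊ * T)]
  rw [hU.add_nat_mul_period hT.le hper (sub_nonneg.2 hn), channel_mul,
    ContinuousLinearMap.comp_apply, hpow]

theorem not_exhibitsCHSE [FiniteDimensional ℂ E] (hd : 2 ≤ Module.finrank ℂ E) {T : ℝ}
    (hT : 0 < T) (hper : H.IsPeriodic T) (hB : H.strength T < ⊤) : ¬ ExhibitsCHSE H := by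
  rintro ⟨U, hU, hlim⟩
  have : Nontrivial E := Module.nontrivial_of_finrank_pos (R := ℂ) (by omega)
  obtain ⟨ψ, c, hψ, hc, hUψ⟩ := exists_unit_eigenvector (hU.mem_unitary hT.le)
  let b := stdOrthonormalBasis ℂ E
  set e₀ := b ⟨0, by omega⟩
  set e₁ := b ⟨1, by omega⟩
  have h₀ : ‖e₀‖ = 1 := b.norm_eq_one _
  have h₁ : ‖e₁‖ = 1 := b.norm_eq_one _
  have h₀₁ : inner ℂ e₀ e₁ = 0 := b.inner_eq_zero (by simp)
  obtain ⟨K, hK, hKdim, hUK⟩ := hU.exists_isCompact_dimH_le_one hB ψ e₀ e₁ hψ h₀ h₁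
  obtain ⟨z, hz, hzK⟩ := exists_mem_ball_notMem hKdim (r := 1 / 2) (by norm_num)
  obtain ⟨φ, hφ, hφz⟩ := exists_norm_eq_one_inner_mul_inner h₀ h₁ h₀₁ (mem_ball_zero_iff.1 hz)
  obtain ⟨V, hV⟩ := exists_unitary_apply_eq hψ hφ
  -- `f` sees only one off-diagonal entry of `ρ`: it vanishes on the orbit of `ψ`, but not at `φ`,
  -- the image of `ψ` under `V`.
  let f : Op E → ℝ := fun ρ => Metric.infDist (inner ℂ e₁ (ρ e₀)) K
  have hf : Continuous f := (Metric.continuous_infDist_pt K).comp (by fun_prop)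
  have hfr (χ : E) : f (InnerProductSpace.rankOne ℂ χ χ)
      = Metric.infDist (inner ℂ χ e₀ * inner ℂ e₁ χ) K := by
    simp only [f, InnerProductSpace.rankOne_apply, inner_smul_right]
  have hK0 : K.Nonempty := ⟨_, hUK 0 ⟨le_rfl, hT.le⟩⟩
  have hzero := (hlim _ ⟨ψ, hψ, rfl⟩ f hf.continuousOn).eq_zero fun t ht => by
    obtain ⟨s, hs, hst⟩ := hU.exists_mem_Icc_channel_eq hT hper
      (ρ := InnerProductSpace.rankOne ℂ ψ ψ)
      (by rw [channel_rankOne, hUψ, rankOne_smul_self hc]) ht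
    rw [hst, channel_rankOne, hfr]
    exact Metric.infDist_zero_of_mem (hUK s hs)
  refine (integral_haarUnitary_pos (V := V) ?_ (fun _ => Metric.infDist_nonneg) ?_).ne' hzero
  · exact hf.comp ((continuous_channel.comp continuous_subtype_val).clm_apply continuous_const)
  · change f _ ≠ 0
    rw [channel_rankOne, hfr, hV, hφz]
    exact ((hK.isClosed.notMem_iff_infDist_pos hK0).1 hzK).ne'

end

end QuantumErgodicity

theorem theorem1 {E : Type*} [NormedAddCommGroup E] [InnerProductSpace ℂ E] [CompleteSpace E]
    [FiniteDimensional ℂ E] (hd : 2 ≤ Module.finrank ℂ E)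
    (H : QuantumErgodicity.Hamiltonian E) (T : ℝ) (hT : 0 < T)
    (hper : H.IsPeriodic T) (hB : H.strength T < ⊤) :
    ¬ QuantumErgodicity.ExhibitsCHSE H ∧ ¬ QuantumErgodicity.ExhibitsCUE H := by
  have h := QuantumErgodicity.not_exhibitsCHSE hd hT hper hB
  exact ⟨h, fun hC => h hC.exhibitsCHSE⟩
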